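/- Consider the $\mathrm{CONGEST}(B)$ model: the nodes of a connected weighted graph on $n$ nodes, whose identifiers are $1,\dots,n$, compute in synchronous rounds; in each round each node may send a message of at most $B$ bits to each of its neighbors. Initially each node knows $n$, its own identifier, the identifiers of its neighbors, the weights of its incident edges, and a private infinite string of independent unbiased random bits; local computation is unrestricted. A name-independent routing scheme with $R$ rounds of table construction is an algorithm after whose first $R$ rounds each node $v$ holds a table $\mathrm{next}_v$, which maps the label of a packet at $v$ to a next hop and a new label that the packet carries on this hop (stateful routing; stateless routing is the case in which the label never changes). A packet with destination $u$ starts with the identifier of $u$ as its label and follows the tables. The stretch of a pair $(v,u)$ with $v\neq u$ is the total weight of the route from $v$ until its first arrival at $u$, divided by the weighted distance of $v$ and $u$; it is $\infty$ if the tables do not lead from $v$ to $u$ along edges of the graph. The average stretch is the mean of the stretch over all $n(n-1)$ ordered pairs of distinct nodes, and the expected average stretch is its expectation over the random strings. **Theorem.** For each $\beta>0$ there is a constant $c>0$ such that the following holds for all integers $n\ge 2$, $R\ge 1$ and $0\le B\le\beta\log n$, and all real $\rho\ge 1$. If a (randomized or deterministic, stateful or stateless) name-independent routing scheme with messages of at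 most $B$ bits and $R$ rounds of table construction has expected average stretch at most $\rho$ on each tree on $n$ nodes with identifiers $1,\dots,n$, all edge weights $1$, and depth at most $2$ (for a suitable root), then $$R\;\ge\; c\,\frac{n}{\rho^2\log n}.$$ In particular, any name-independent routing scheme of (expected) average stretch $\rho$ on all connected weighted graphs needs $\Omega(n/(\rho^2\log n))$ rounds for table construction in CONGEST. -/

import Mathlib

open MeasureTheory
open scoped ENNReal

namespace Congest

/-- A simple, connected graph with positive integral edge weights. A node and its identifier are
the same thing; the node `v : Fin n` has the identifier `v + 1`, so that the identifiers are
`1, …, n`. -/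
structure Network (n : ℕ) where
  graph : SimpleGraph (Fin n)
  connected : graph.Connected
  weight : Sym2 (Fin n) → ℕ
  weight_pos : ∀ e ∈ graph.edgeSet, 0 < weight e

/-- The identifier, in `{1, …, n}`, of a node. -/
def ident {n : ℕ} (v : Fin n) : ℕ := (v : ℕ) + 1

/-- What a node knows at the start (besides `n` and its own identifier): for each identifier,
whether it belongs to a neighbor and, if so, the weight of the edge to that neighbor. -/
abbrev LocalInput (n : ℕ) : Type := Fin n → Option ℕ

open Classical in
/-- The local input of the node `v` in the network `N`. -/
noncomputable def Network.localInput {n : ℕ} (N : Network n) (v : Fin n) : LocalInput n :=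
  fun u => if N.graph.Adj v u then some (N.weight s(v, u)) else none

/-- Messages consist of at most `B` bits; the empty message means that nothing is sent. -/
abbrev Message (B : ℕ) : Type := {m : List Bool // m.length ≤ B}

/-- The empty message. -/
def Message.empty (B : ℕ) : Message B := ⟨[], Nat.zero_le B⟩

/-- The messages that a node receives in one round, indexed by the sender. -/
abbrev Inbox (n B : ℕ) : Type := Fin n → Message B

/-- An infinite string of random bits. -/
abbrev Coins : Type := ℕ → Bool

/-- The law of an infinite string of independent unbiased bits. -/
noncomputable def coinLaw : Measure Coins :=
  Measure.infinitePi fun _ : ℕ => (PMF.uniformOfFintype Bool).toMeasure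

/-- A randomized distributed algorithm for the construction of name-independent (stateful) routing
tables on networks with `n` nodes, by messages of at most `B` bits. Local computation and local
memory are unrestricted, so everything that a node does is a function of its identifier, its local
input, its own random string and the list of all inboxes received so far (the latest one first;
its length is the number of elapsed rounds).

* `send v I ω h u` is the message that `v` sends to `u` in the next round.
* `next v I ω h` is the routing table of `v` if the construction stops at this moment. It maps the
  label of a packet at `v` to the next hop and the label that the packet carries on that hop.
  Labels are natural numbers, i.e. codes of finite strings of any length. Stateless routing is the
  case in which the label never changes. -/
structure RoutingAlgorithm (n B : ℕ) where
  send : Fin n → LocalInput n → Coins → List (Inbox n B) → Fin n → Message B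
  next : Fin n → LocalInput n → Coins → List (Inbox n B) → ℕ → Fin n × ℕ
  measurable_send : ∀ v I h u m, MeasurableSet {ω : Coins | send v I ω h u = m}
  measurable_next : ∀ v I h l p, MeasurableSet {ω : Coins | next v I ω h l = p}

open Classical in
/-- The inboxes that the node `v` has received in the first `t` rounds of the execution of `A` on
`N` with random strings `ω`. A round delivers on each edge one message in each direction. -/
noncomputable def history {n B : ℕ} (A : RoutingAlgorithm n B) (N : Network n)
    (ω : Fin n → Coins) : ℕ → Fin n → List (Inbox n B)
  | 0, _ => []
  | t + 1, v =>
      (fun u => if N.graph.Adj u v then A.send u (N.localInput u) (ω u) (history A N ω t u) v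
        else Message.empty B) :: history A N ω t v

/-- A routing table for every node: current node and label of the packet are mapped to next hop
and new label. -/
abbrev Tables (n : ℕ) : Type := Fin n → ℕ → Fin n × ℕ

/-- The tables that `A` has constructed on `N` after `R` rounds. -/
noncomputable def tables {n B : ℕ} (A : RoutingAlgorithm n B) (N : Network n) (R : ℕ)
    (ω : Fin n → Coins) : Tables n :=
  fun v => A.next v (N.localInput v) (ω v) (history A N ω R v)

/-- Position and label, after `i` hops, of a packet that starts at `v` with destination `u`.
Routing is name-independent: the packet starts with the identifier of `u` as its label. -/
def packet {n : ℕ} (T : Tables n) (v u : Fin n) : ℕ → Fin n × ℕ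
  | 0 => (v, ident u)
  | i + 1 => T (packet T v u i).1 (packet T v u i).2

/-- The first `i` hops from `v` towards `u` run along edges of `N` and end at `u`. -/
def Delivered {n : ℕ} (N : Network n) (T : Tables n) (v u : Fin n) (i : ℕ) : Prop :=
  (∀ j < i, N.graph.Adj (packet T v u j).1 (packet T v u (j + 1)).1) ∧ (packet T v u i).1 = u

/-- The total weight of the route from `v` to the first arrival at `u` (where the infimum is
attained); it is `⊤` if the tables do not lead from `v` to `u`. -/
noncomputable def routeWeight {n : ℕ} (N : Network n) (T : Tables n) (v u : Fin n) : ℝ≥0∞ :=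
  ⨅ (i : ℕ) (_ : Delivered N T v u i),
    ((∑ j ∈ Finset.range i, N.weight s((packet T v u j).1, (packet T v u (j + 1)).1) : ℕ) : ℝ≥0∞)

/-- The weighted distance: the least total weight of a path from `v` to `u`. -/
noncomputable def Network.wdist {n : ℕ} (N : Network n) (v u : Fin n) : ℝ≥0∞ :=
  ⨅ p : N.graph.Walk v u, (((p.edges.map N.weight).sum : ℕ) : ℝ≥0∞)

/-- The stretch of the route from `v` to `u`. -/
noncomputable def stretch {n : ℕ} (N : Network n) (T : Tables n) (v u : Fin n) : ℝ≥0∞ :=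
  routeWeight N T v u / N.wdist v u

/-- The average of the stretch over all ordered pairs of distinct nodes. -/
noncomputable def averageStretch {n : ℕ} (N : Network n) (T : Tables n) : ℝ≥0∞ :=
  (∑ v : Fin n, ∑ u ∈ Finset.univ.erase v, stretch N T v u) / ((n * (n - 1) : ℕ) : ℝ≥0∞)

/-- The expected average stretch of the tables that `A` has constructed on `N` after `R` rounds,
where the nodes have independent random strings. -/
noncomputable def expectedAverageStretch {n B : ℕ} (A : RoutingAlgorithm n B) (N : Network n)
    (R : ℕ) : ℝ≥0∞ :=
  ∫⁻ ω, averageStretch N (tables A N R ω) ∂(Measure.pi fun _ : Fin n => coinLaw)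

/-- All edge weights are `1`. -/
def Network.UnitWeights {n : ℕ} (N : Network n) : Prop :=
  ∀ e ∈ N.graph.edgeSet, N.weight e = 1

/-- The graph is a tree which has, for a suitable root, depth at most `D`. -/
def Network.IsTreeOfDepthLE {n : ℕ} (N : Network n) (D : ℕ) : Prop :=
  N.graph.IsTree ∧ ∃ r : Fin n, ∀ v : Fin n, N.graph.dist r v ≤ D

end Congest

namespace Congest

/-! Consider trees with a root, `k` inner nodes below it (`k` of order `ρ`), leaves distributed over
the inner nodes by a function `f`, and further nodes, the senders, attached to the root. Fix two
inner nodes. Which of the leaves below them belong to which one is known outside of their two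
subtrees only through the messages that the two nodes send to the root, that is, through `O(R * B)`
bits. A packet from a sender to such a leaf enters these subtrees at one of the two inner nodes, so
its entry point is a guess of one bit of `f`, and a wrong guess is a visit to the wrong inner node
(`EqUpTo.not_avoids`). For uniform `f` a constant fraction of the guesses fails, up to a loss of
`O(R * B)` (`card_le_log_card_add_card_bad`).

Summed over all pairs of inner nodes, this makes the average route visit a constant fraction of the
`k` inner nodes, unless `k * R * B` is at least of the order of the number of leaves
(`card_leaves_le_add_card_not_avoids`). But senders and leaves have distance at most 3, so a route
of stretch `ρ` visits at most `3 * ρ` inner nodes. For `k` a large multiple of `ρ` this gives `n =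
O(ρ * R * B)`, which is stronger than required by a factor `ρ`. Randomness is removed first: some
fixed strings are good on average over all `f`. -/

/-! ### Guessing a function from a short description. -/

open Finset in
/-- Each function `f : ι → K` is described by a value `τ f ∈ T`, and two functions that differ only
by exchanging `c₁` and `c₂` at some places, with equal descriptions, cannot both be reconstructed
at a place in `D` where they differ (`bad f u` says that the reconstruction of `f` at `u` fails).
Then the number of failures is at least of the order of the number of places, up to `log |T|`. -/
theorem card_le_log_card_add_card_bad {ι K T : Type*} [Fintype ι] [DecidableEq ι] [Fintype K]
    [DecidableEq K] [Fintype T] [Nonempty T] {c₁ c₂ : K} (hc : c₁ ≠ c₂) (D : Finset ι)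
    (τ : (ι → K) → T) (bad : (ι → K) → ι → Prop) [∀ f u, Decidable (bad f u)]
    (h : ∀ f f' : ι → K, (∀ u, f u = f' u ∨ (f u = c₁ ∨ f u = c₂) ∧ (f' u = c₁ ∨ f' u = c₂)) →
      τ f = τ f' → ∀ u ∈ D, f u = c₁ → f' u = c₂ → bad f u ∨ bad f' u) :
    ∑ f : ι → K, (#{u ∈ D | f u = c₁ ∨ f u = c₂} : ℝ) / 4 ≤
      Fintype.card (ι → K) * Real.log (Fintype.card T) +
        ∑ f : ι → K, (#{u ∈ D | (f u = c₁ ∨ f u = c₂) ∧ bad f u} : ℝ) := by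
  classical
  -- `m` merges `c₂` into `c₁`. The merged function is given to the decoder `e` for free, so that
  -- only the choices between `c₁` and `c₂` have to be guessed.
  let m : K → K := fun c => if c = c₂ then c₁ else c
  have hm : ∀ f f' : ι → K, (fun u => m (f u)) = (fun u => m (f' u)) →
      ∀ u, f u = f' u ∨ (f u = c₁ ∨ f u = c₂) ∧ (f' u = c₁ ∨ f' u = c₂) := by
    intro f f' hff u
    have := congrFun hff u
    simp only [m] at this
    split_ifs at this with h1 h2 h2
    · exact Or.inl (h1.trans h2.symm)
    · exact Or.inr ⟨Or.inr h1, Or.inl this.symm⟩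
    · exact Or.inr ⟨Or.inl this, Or.inr h2⟩
    · exact Or.inl this
  let e : (ι → K) → T → ι → K := fun g t u =>
    if ∃ f : ι → K, (fun u => m (f u)) = g ∧ τ f = t ∧ f u = c₁ ∧ ¬ bad f u then c₁ else c₂
  have he : ∀ f : ι → K, ∀ u ∈ D, (f u = c₁ ∨ f u = c₂) →
      f u ≠ e (fun u => m (f u)) (τ f) u → bad f u := by
    intro f u hu hf hne
    simp only [e] at hne
    split_ifs at hne with hex
    · obtain ⟨f', hg, ht, hf', hb⟩ := hex
      exact (h f' f (hm _ _ hg) ht u hu hf' (hf.resolve_left hne)).resolve_left hb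
    · by_contra hb
      exact hex ⟨f, rfl, rfl, hf.resolve_right hne, hb⟩
  -- A right guess has weight `exp (1/4)`, a wrong one `exp (-3/4)`. The sum is below 2, so the mean
  -- weight over the two possible values is at most 1; the quotient `exp 1` charges a wrong guess
  -- exactly one unit.
  let w : K → ι → K → ℝ := fun a u j =>
    if u ∈ D ∧ (j = c₁ ∨ j = c₂) then (if j = a then Real.exp (1 / 4) else Real.exp (-3 / 4)) else 1
  have hw0 : ∀ a u j, 0 ≤ w a u j := by
    intro a u j
    simp only [w]
    split_ifs <;> positivity
  have hsum2 : Real.exp (1 / 4) + Real.exp (-3 / 4) ≤ 2 := by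
    have h1 := Real.add_one_le_exp (-(1 / 4 : ℝ))
    have h2 := Real.add_one_le_exp (3 / 4 : ℝ)
    have e1 : Real.exp (1 / 4) = (Real.exp (-(1 / 4 : ℝ)))⁻¹ := by rw [Real.exp_neg, inv_inv]
    have e2 : Real.exp (-3 / 4) = (Real.exp (3 / 4 : ℝ))⁻¹ := by rw [← Real.exp_neg]; norm_num
    have h3 : Real.exp (1 / 4) ≤ 4 / 3 := by
      rw [e1, show (4 / 3 : ℝ) = (3 / 4)⁻¹ by norm_num]
      exact inv_anti₀ (by norm_num) (by linarith)
    have h4 : Real.exp (-3 / 4) ≤ 4 / 7 := by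
      rw [e2, show (4 / 7 : ℝ) = (7 / 4)⁻¹ by norm_num]
      exact inv_anti₀ (by norm_num) (by linarith)
    linarith
  have hexp1 : Real.exp (-3 / 4) ≤ 1 := Real.exp_le_one_iff.2 (by norm_num)
  have hfac : ∀ (a : K) (u : ι) (b : K), ∑ j with m j = b, w a u j ≤ #{j | m j = b} := by
    intro a u b
    by_cases hu : u ∈ D
    swap
    · simp [w, hu]
    by_cases hb1 : b = c₁
    · have : ({j | m j = b} : Finset K) = {c₁, c₂} := by
        ext j
        simp only [m, mem_filter, mem_univ, true_and, mem_insert, mem_singleton, hb1]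
        split_ifs with hj <;> simp [hj]
      rw [this, sum_pair hc, card_pair hc]
      simp only [w, hu, true_and, true_or, or_true, if_true]
      push_cast
      split_ifs with h1 h2 h2
      · exact absurd (h1.trans h2.symm) hc
      · exact hsum2
      · linarith
      · linarith
    · refine (sum_le_card_nsmul _ _ 1 fun j hj => ?_).trans (by simp)
      simp only [m, mem_filter, mem_univ, true_and] at hj
      split_ifs at hj with hj2
      · exact absurd hj.symm hb1
      · simp only [w]
        rw [if_neg]
        rintro ⟨-, h1 | h1⟩
        · exact hb1 (hj ▸ h1)
        · exact hj2 h1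
  -- For fixed `g` and `t` the guesses are fixed and the class of `g` is a product set, so the sum
  -- factorizes over the places.
  have hclass : ∀ (g : ι → K) (t : T),
      ∑ f : ι → K with (fun u => m (f u)) = g, ∏ u, w (e g t u) u (f u) ≤
        #{f : ι → K | (fun u => m (f u)) = g} := by
    intro g t
    have : ({f : ι → K | (fun u => m (f u)) = g} : Finset (ι → K)) =
        Fintype.piFinset fun u => {j | m j = g u} := by
      ext f
      simp [funext_iff]
    rw [this, ← Finset.prod_univ_sum, Fintype.card_piFinset]
    push_cast
    exact prod_le_prod (fun u _ => sum_nonneg fun j _ => hw0 _ _ _) fun u _ => hfac _ _ _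
  have hall : ∀ t : T, ∑ f : ι → K, ∏ u, w (e (fun u => m (f u)) t u) u (f u) ≤
      Fintype.card (ι → K) := by
    intro t
    rw [← sum_fiberwise univ (fun (f : ι → K) u => m (f u)), ← card_univ,
      card_eq_sum_card_fiberwise (f := fun (f : ι → K) u => m (f u)) (t := univ) (by simp)]
    push_cast
    refine sum_le_sum fun g _ => (le_of_eq ?_).trans (hclass g t)
    refine sum_congr rfl fun f hf => ?_
    rw [(mem_filter.1 hf).2]
  let U : (ι → K) → ℝ := fun f => #{u ∈ D | f u = c₁ ∨ f u = c₂}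
  let b : (ι → K) → ℝ := fun f => #{u ∈ D | (f u = c₁ ∨ f u = c₂) ∧ bad f u}
  have hpoint : ∀ f : ι → K, Real.exp (U f / 4 - b f) ≤
      ∏ u, w (e (fun u => m (f u)) (τ f) u) u (f u) := by
    intro f
    have : U f / 4 - b f = ∑ u, ((if u ∈ D ∧ (f u = c₁ ∨ f u = c₂) then (1 / 4 : ℝ) else 0) -
        if u ∈ D ∧ (f u = c₁ ∨ f u = c₂) ∧ bad f u then 1 else 0) := by
      simp only [U, b, sum_sub_distrib, card_filter, Nat.cast_sum, sum_div, ite_and, sum_ite_mem,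
        univ_inter]
      congr 1
      · refine sum_congr rfl fun u _ => ?_
        split_ifs <;> simp
      · refine sum_congr rfl fun u _ => ?_
        split_ifs <;> simp
    rw [this, Real.exp_sum]
    refine prod_le_prod (fun u _ => (Real.exp_pos _).le) fun u _ => ?_
    simp only [w]
    by_cases hu : u ∈ D ∧ (f u = c₁ ∨ f u = c₂)
    · rw [if_pos hu, if_pos hu]
      split_ifs with h1 h2 h2
      · exact Real.exp_le_exp.2 (by norm_num)
      · exact Real.exp_le_exp.2 (by norm_num)
      · exact Real.exp_le_exp.2 (by norm_num)
      · exact absurd ⟨hu.1, hu.2, he f u hu.1 hu.2 h2⟩ h1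
    · rw [if_neg hu, if_neg hu, if_neg fun h' => hu ⟨h'.1, h'.2.1⟩]
      simp
  have hT : (0 : ℝ) < Fintype.card T := Nat.cast_pos.2 Fintype.card_pos
  -- Union bound: since `τ f` depends on `f`, all values `t` are admitted, at the cost of a factor
  -- `|T|`.
  have htotal : ∑ f : ι → K, Real.exp (U f / 4 - b f) ≤
      Fintype.card T * Fintype.card (ι → K) := by
    calc ∑ f : ι → K, Real.exp (U f / 4 - b f)
        ≤ ∑ f : ι → K, ∑ t : T, ∏ u, w (e (fun u => m (f u)) t u) u (f u) :=
          sum_le_sum fun f _ => (hpoint f).trans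
            (single_le_sum (f := fun t => ∏ u, w (e (fun u => m (f u)) t u) u (f u))
              (fun t _ => prod_nonneg fun u _ => hw0 _ _ _) (mem_univ (τ f)))
      _ = ∑ t : T, ∑ f : ι → K, ∏ u, w (e (fun u => m (f u)) t u) u (f u) := sum_comm
      _ ≤ ∑ t : T, (Fintype.card (ι → K) : ℝ) := sum_le_sum fun t _ => hall t
      _ = _ := by simp
  -- Jensen's inequality for `exp`, in the form `x + 1 ≤ exp x`.
  have hlin : ∑ f : ι → K, (U f / 4 - b f - Real.log (Fintype.card T) + 1) ≤
      Fintype.card (ι → K) := by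
    calc ∑ f : ι → K, (U f / 4 - b f - Real.log (Fintype.card T) + 1)
        ≤ ∑ f : ι → K, Real.exp (U f / 4 - b f) / Fintype.card T := by
          refine sum_le_sum fun f _ => (Real.add_one_le_exp _).trans ?_
          rw [Real.exp_sub, Real.exp_log hT]
      _ = (∑ f : ι → K, Real.exp (U f / 4 - b f)) / Fintype.card T := by rw [sum_div]
      _ ≤ _ := by rw [div_le_iff₀ hT, mul_comm]; exact htotal
  simp only [sum_add_distrib, sum_sub_distrib, sum_const, card_univ, nsmul_eq_mul, mul_one] at hlin
  change ∑ f, U f / 4 ≤ _ + ∑ f, b f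
  linarith


/-! ### The hard trees, and stretch as a bound on visited inner nodes. -/

/-- The fixed part of a family of trees: a root, `k` inner nodes, and a set of leaves each of which
will be attached to one of the inner nodes. All other nodes are attached to the root. -/
structure Layout (n k : ℕ) where
  root : Fin n
  inner : Fin k → Fin n
  leaves : Finset (Fin n)
  inner_injective : Function.Injective inner
  inner_ne_root : ∀ c, inner c ≠ root
  root_notMem : root ∉ leaves
  inner_notMem : ∀ c, inner c ∉ leaves

namespace Layout

variable {n k : ℕ} (L : Layout n k) (f : Fin n → Fin k)

/-- The parent of a node if `f` says where the leaves are attached. -/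
def parent (x : Fin n) : Fin n := if x ∈ L.leaves then L.inner (f x) else L.root

/-- The graph of the tree in which `f` says where the leaves are attached. -/
def graph : SimpleGraph (Fin n) := SimpleGraph.fromRel fun x y => L.parent f x = y

theorem parent_of_mem {x : Fin n} (hx : x ∈ L.leaves) : L.parent f x = L.inner (f x) := if_pos hx

theorem parent_of_notMem {x : Fin n} (hx : x ∉ L.leaves) : L.parent f x = L.root := if_neg hx

theorem adj_iff {x y : Fin n} :
    (L.graph f).Adj x y ↔ x ≠ y ∧ (L.parent f x = y ∨ L.parent f y = x) :=
  SimpleGraph.fromRel_adj _ _ _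

theorem parent_ne {x : Fin n} (hx : x ≠ L.root) : L.parent f x ≠ x := by
  unfold parent
  split_ifs with h
  · exact fun h' => L.inner_notMem (f x) (h'.symm ▸ h)
  · exact hx.symm

theorem adj_parent {x : Fin n} (hx : x ≠ L.root) : (L.graph f).Adj x (L.parent f x) :=
  (L.adj_iff f).2 ⟨(L.parent_ne f hx).symm, Or.inl rfl⟩

theorem adj_inner_root (c : Fin k) : (L.graph f).Adj (L.inner c) L.root := by
  have := L.adj_parent f (L.inner_ne_root c)
  rwa [L.parent_of_notMem f (L.inner_notMem c)] at this

theorem adj_inner {u : Fin n} (hu : u ∈ L.leaves) : (L.graph f).Adj u (L.inner (f u)) := by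
  have := L.adj_parent f (x := u) (fun h => L.root_notMem (h ▸ hu))
  rwa [L.parent_of_mem f hu] at this

theorem adj_leaf_iff {u y : Fin n} (hu : u ∈ L.leaves) :
    (L.graph f).Adj u y ↔ y = L.inner (f u) := by
  refine ⟨fun h => ?_, fun h => h ▸ L.adj_inner f hu⟩
  obtain ⟨-, h | h⟩ := (L.adj_iff f).1 h
  · rw [← h, L.parent_of_mem f hu]
  · exfalso
    unfold parent at h
    split_ifs at h
    · exact L.inner_notMem _ (h ▸ hu)
    · exact L.root_notMem (h ▸ hu)

theorem adj_root {v : Fin n} (hv : v ∉ L.leaves) (hr : v ≠ L.root) :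
    (L.graph f).Adj v L.root := by
  have := L.adj_parent f hr
  rwa [L.parent_of_notMem f hv] at this

theorem exists_walk_root (x : Fin n) : ∃ p : (L.graph f).Walk L.root x, p.length ≤ 2 := by
  by_cases hr : x = L.root
  · subst hr
    exact ⟨.nil, by simp⟩
  by_cases hx : x ∈ L.leaves
  · exact ⟨.cons (L.adj_inner_root f (f x)).symm (.cons (L.adj_inner f hx).symm .nil), by simp⟩
  · exact ⟨.cons (L.adj_root f hx hr).symm .nil, by simp⟩

theorem connected : (L.graph f).Connected where
  preconnected x y := by
    obtain ⟨p, -⟩ := L.exists_walk_root f x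
    obtain ⟨q, -⟩ := L.exists_walk_root f y
    exact ⟨p.reverse.append q⟩
  nonempty := ⟨L.root⟩

/-- Every edge joins a node other than the root to its parent, so a connected graph has at most `n -
1` edges here. -/
theorem isTree : (L.graph f).IsTree := by
  rw [SimpleGraph.isTree_iff_connected_and_card]
  refine ⟨L.connected f, le_antisymm ?_ (L.connected f).card_vert_le_card_edgeSet_add_one⟩
  have hsub : (L.graph f).edgeSet ⊆
      ((Finset.univ.erase L.root).image fun x => s(x, L.parent f x) : Finset (Sym2 (Fin n))) := by
    intro e
    induction e with
    | h x y =>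
      intro he
      have key : ∀ x y : Fin n, x ≠ y → L.parent f x = y → s(x, y) ∈
          (Finset.univ.erase L.root).image fun x => s(x, L.parent f x) := by
        intro x y hne hp
        refine Finset.mem_image.2 ⟨x, Finset.mem_erase.2 ⟨?_, Finset.mem_univ _⟩, by rw [hp]⟩
        rintro rfl
        exact hne (by rw [← hp, L.parent_of_notMem f L.root_notMem])
      rw [SimpleGraph.mem_edgeSet] at he
      obtain ⟨hne, h | h⟩ := (L.adj_iff f).1 he
      · exact key x y hne h
      · rw [Sym2.eq_swap]
        exact key y x hne.symm h
  have h1 := Set.ncard_le_ncard hsub (Finset.finite_toSet _)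
  rw [Set.ncard_coe_finset] at h1
  have h2 := h1.trans Finset.card_image_le
  rw [Finset.card_erase_of_mem (Finset.mem_univ _), Finset.card_univ, Fintype.card_fin] at h2
  have h3 : 0 < n := L.root.pos
  rw [Nat.card_eq_fintype_card (α := Fin n), Fintype.card_fin]
  have h4 : Nat.card (L.graph f).edgeSet = (L.graph f).edgeSet.ncard := rfl
  omega

/-- The tree in which `f` says where the leaves are attached, with unit weights. -/
def tree : Network n where
  graph := L.graph f
  connected := L.connected f
  weight := fun _ => 1
  weight_pos := fun _ _ => Nat.one_pos

theorem tree_isTreeOfDepthLE : (L.tree f).IsTreeOfDepthLE 2 := by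
  refine ⟨L.isTree f, L.root, fun v => ?_⟩
  obtain ⟨p, hp⟩ := L.exists_walk_root f v
  exact (SimpleGraph.dist_le p).trans hp

theorem tree_unitWeights : (L.tree f).UnitWeights := fun _ _ => rfl

theorem wdist_le {v u : Fin n} (hv : v ∉ L.leaves) (hr : v ≠ L.root) (hu : u ∈ L.leaves) :
    (L.tree f).wdist v u ≤ 3 := by
  let p : (L.tree f).graph.Walk v u := .cons (L.adj_root f hv hr)
    (.cons (L.adj_inner_root f (f u)).symm (.cons (L.adj_inner f hu).symm .nil))
  refine (iInf_le _ p).trans ?_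
  simp [p, tree]

/-- The tables lead from `v` to `u` without passing the node `x`. -/
def Avoids (T : Tables n) (v u x : Fin n) : Prop :=
  ∃ i, Delivered (L.tree f) T v u i ∧ ∀ j ≤ i, (packet T v u j).1 ≠ x

open Classical in
-- With unit weights a delivering route of `i` hops has weight `i`, and it must meet each inner node
-- that is not avoided, distinct ones after distinct numbers of hops. Without delivery the right
-- side is `⊤`.
theorem card_not_avoids_le (T : Tables n) {v u : Fin n} (hv : ∀ c, v ≠ L.inner c) :
    ((Finset.univ.filter fun c => ¬ L.Avoids f T v u (L.inner c)).card : ℝ≥0∞) ≤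
      routeWeight (L.tree f) T v u := by
  refine le_iInf₂ fun i hi => ?_
  simp only [tree, Finset.sum_const, Finset.card_range, smul_eq_mul, mul_one, Nat.cast_le]
  have hex : ∀ c, ¬ L.Avoids f T v u (L.inner c) → ∃ j, j < i ∧
      (packet T v u (j + 1)).1 = L.inner c := by
    intro c hc
    by_contra! hno
    refine hc ⟨i, hi, fun j hj => ?_⟩
    cases j with
    | zero => exact hv c
    | succ j => exact hno j hj
  rw [← Finset.card_image_of_injective _ L.inner_injective]
  refine (Finset.card_le_card_of_surjOn (s := Finset.range i)
    (fun j => (packet T v u (j + 1)).1) ?_).trans_eq (Finset.card_range i)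
  intro x hx
  obtain ⟨c, hc, rfl⟩ := Finset.mem_image.1 (Finset.mem_coe.1 hx)
  obtain ⟨j, hj, hjc⟩ := hex c (Finset.mem_filter.1 hc).2
  exact ⟨j, by simpa using hj, hjc⟩

open Classical in
theorem card_not_avoids_le_stretch (T : Tables n) {v u : Fin n} (hv : v ∉ L.leaves)
    (hr : v ≠ L.root) (hi : ∀ c, v ≠ L.inner c) (hu : u ∈ L.leaves) :
    ((Finset.univ.filter fun c => ¬ L.Avoids f T v u (L.inner c)).card : ℝ≥0∞) ≤
      3 * stretch (L.tree f) T v u := by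
  refine (L.card_not_avoids_le f T hi).trans ?_
  calc routeWeight (L.tree f) T v u = 3 * (routeWeight (L.tree f) T v u / 3) :=
        (ENNReal.mul_div_cancel (by norm_num) (by norm_num)).symm
    _ ≤ _ := by
        unfold stretch
        gcongr
        exact L.wdist_le f hv hr hu

end Layout
-- Locality: what is known outside of two subtrees.
namespace Layout

variable {n k : ℕ} (L : Layout n k)

/-- The inner nodes `c₁` and `c₂` and the leaves attached to them. -/
def region (c₁ c₂ : Fin k) (f : Fin n → Fin k) : Set (Fin n) :=
  {x | x = L.inner c₁ ∨ x = L.inner c₂ ∨ x ∈ L.leaves ∧ (f x = c₁ ∨ f x = c₂)}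

/-- The functions `f` and `f'` differ only by exchanging `c₁` and `c₂` at some places. -/
def EqUpTo (c₁ c₂ : Fin k) (f f' : Fin n → Fin k) : Prop :=
  ∀ u, f u = f' u ∨ (f u = c₁ ∨ f u = c₂) ∧ (f' u = c₁ ∨ f' u = c₂)

variable {L} {c₁ c₂ : Fin k} {f f' : Fin n → Fin k}

theorem EqUpTo.symm (h : EqUpTo c₁ c₂ f f') : EqUpTo c₁ c₂ f' f :=
  fun u => (h u).imp Eq.symm And.symm

theorem EqUpTo.region_eq (h : EqUpTo c₁ c₂ f f') : L.region c₁ c₂ f = L.region c₁ c₂ f' := by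
  ext x
  rcases h x with h | ⟨h1, h2⟩
  · simp [region, h]
  · simp [region, h1, h2]

theorem EqUpTo.eq_of_notMem (h : EqUpTo c₁ c₂ f f') {x : Fin n} (hx : x ∈ L.leaves)
    (hr : x ∉ L.region c₁ c₂ f) : f x = f' x := by
  refine (h x).resolve_right fun h' => hr (Or.inr (Or.inr ⟨hx, h'.1⟩))

theorem EqUpTo.adj_of_adj (h : EqUpTo c₁ c₂ f f') {x y : Fin n} (hy : y ∉ L.region c₁ c₂ f)
    (hadj : (L.graph f).Adj y x) : (L.graph f').Adj y x := by
  have key : ∀ z, (z ∈ L.leaves → f z = f' z) → L.parent f z = L.parent f' z := by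
    intro z hz
    unfold parent
    split_ifs with h'
    · rw [hz h']
    · rfl
  obtain ⟨hne, hp | hp⟩ := (L.adj_iff f).1 hadj
  · exact (L.adj_iff f').2 ⟨hne, Or.inl (by rw [← key y fun hl => h.eq_of_notMem hl hy, hp])⟩
  · refine (L.adj_iff f').2 ⟨hne, Or.inr ?_⟩
    -- A leaf `x` that may change its parent has its present parent in the region, whereas here this
    -- parent is `y`.
    rw [← key x fun hl => (h x).resolve_right ?_, hp]
    rintro ⟨hx, -⟩
    rw [L.parent_of_mem f hl] at hp
    rcases hx with hx | hx
    · exact hy (Or.inl (by rw [← hp, hx]))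
    · exact hy (Or.inr (Or.inl (by rw [← hp, hx])))

theorem EqUpTo.adj_iff_adj (h : EqUpTo c₁ c₂ f f') {x y : Fin n} (hy : y ∉ L.region c₁ c₂ f) :
    (L.graph f).Adj y x ↔ (L.graph f').Adj y x :=
  ⟨h.adj_of_adj hy, h.symm.adj_of_adj (h.region_eq ▸ hy)⟩

theorem EqUpTo.localInput_eq (h : EqUpTo c₁ c₂ f f') {y : Fin n} (hy : y ∉ L.region c₁ c₂ f) :
    (L.tree f).localInput y = (L.tree f').localInput y := by
  funext x
  have := h.adj_iff_adj (x := x) hy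
  by_cases ha : (L.graph f).Adj y x
  · simp [Network.localInput, tree, ha, this.1 ha]
  · simp [Network.localInput, tree, ha, mt this.2 ha]

/-- An edge that leaves the region joins one of its two inner nodes with the root. -/
theorem adj_region {x y : Fin n} (hx : x ∈ L.region c₁ c₂ f) (hy : y ∉ L.region c₁ c₂ f)
    (hadj : (L.graph f).Adj x y) : (x = L.inner c₁ ∨ x = L.inner c₂) ∧ y = L.root := by
  have key : ∀ c, (c = c₁ ∨ c = c₂) → (L.graph f).Adj (L.inner c) y → y = L.root := by
    intro c hc ha
    obtain ⟨-, hp | hp⟩ := (L.adj_iff f).1 ha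
    · rw [← hp, L.parent_of_notMem f (L.inner_notMem c)]
    · exfalso
      unfold parent at hp
      split_ifs at hp with hl
      · rw [L.inner_injective.eq_iff] at hp
        exact hy (Or.inr (Or.inr ⟨hl, hp ▸ hc⟩))
      · exact L.inner_ne_root c hp.symm
  rcases hx with rfl | rfl | ⟨hl, hf⟩
  · exact ⟨Or.inl rfl, key c₁ (Or.inl rfl) hadj⟩
  · exact ⟨Or.inr rfl, key c₂ (Or.inr rfl) hadj⟩
  · exfalso
    rw [L.adj_leaf_iff f hl] at hadj
    rcases hf with hf | hf
    · exact hy (Or.inl (by rw [hadj, hf]))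
    · exact hy (Or.inr (Or.inl (by rw [hadj, hf])))

variable (L) {B : ℕ} (A : RoutingAlgorithm n B) (ω : Fin n → Coins)

/-- The message that the inner node `c` sends to the root after `t` rounds. -/
noncomputable def report (f : Fin n → Fin k) (t : ℕ) (c : Fin k) : Message B :=
  A.send (L.inner c) ((L.tree f).localInput (L.inner c)) (ω (L.inner c))
    (history A (L.tree f) ω t (L.inner c)) L.root

variable {L}

/-- Only the edges from the two inner nodes to the root leave the region. The messages towards the
root on them agree by `hrep`; every other message received outside comes from outside, where inputs
and histories agree by induction. -/
theorem EqUpTo.history_eq (h : EqUpTo c₁ c₂ f f') (R : ℕ)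
    (hrep : ∀ t < R, L.report A ω f t c₁ = L.report A ω f' t c₁ ∧
      L.report A ω f t c₂ = L.report A ω f' t c₂) :
    ∀ t ≤ R, ∀ y ∉ L.region c₁ c₂ f,
      history A (L.tree f) ω t y = history A (L.tree f') ω t y := by
  classical
  intro t
  induction t with
  | zero => intros; rfl
  | succ t ih =>
    intro ht y hy
    simp only [history]
    rw [ih (by omega) y hy]
    congr 1
    funext u
    have hadj : (L.tree f).graph.Adj u y ↔ (L.tree f').graph.Adj u y := by
      rw [SimpleGraph.adj_comm, (L.tree f').graph.adj_comm]
      exact h.adj_iff_adj hy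
    by_cases ha : (L.tree f).graph.Adj u y
    · rw [if_pos ha, if_pos (hadj.1 ha)]
      by_cases hu : u ∈ L.region c₁ c₂ f
      · obtain ⟨rfl | rfl, rfl⟩ := adj_region hu hy ha
        · exact (hrep t (by omega)).1
        · exact (hrep t (by omega)).2
      · rw [h.localInput_eq hu, ih (by omega) u hu]
    · rw [if_neg ha, if_neg fun h' => ha (hadj.2 h')]

theorem EqUpTo.tables_eq (h : EqUpTo c₁ c₂ f f') (R : ℕ)
    (hrep : ∀ t < R, L.report A ω f t c₁ = L.report A ω f' t c₁ ∧
      L.report A ω f t c₂ = L.report A ω f' t c₂) {y : Fin n} (hy : y ∉ L.region c₁ c₂ f) :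
    tables A (L.tree f) R ω y = tables A (L.tree f') R ω y := by
  unfold tables
  rw [h.localInput_eq hy, h.history_eq A ω R hrep R le_rfl y hy]

theorem exists_first_entry {T : Tables n} {v u : Fin n} (hv : v ∉ L.region c₁ c₂ f)
    (hu : u ∈ L.region c₁ c₂ f) {i : ℕ} (hi : Delivered (L.tree f) T v u i) :
    ∃ j ≤ i, (∀ l < j, (packet T v u l).1 ∉ L.region c₁ c₂ f) ∧
      (packet T v u j).1 ∈ L.region c₁ c₂ f ∧
      ((packet T v u j).1 = L.inner c₁ ∨ (packet T v u j).1 = L.inner c₂) := by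
  classical
  have hiu : (packet T v u i).1 ∈ L.region c₁ c₂ f := by rwa [hi.2]
  have hex : ∃ j, (packet T v u j).1 ∈ L.region c₁ c₂ f := ⟨i, hiu⟩
  refine ⟨Nat.find hex, Nat.find_min' hex hiu, fun l hl => Nat.find_min hex hl,
    Nat.find_spec hex, ?_⟩
  have h0 : Nat.find hex ≠ 0 := by
    intro h0
    have := Nat.find_spec hex
    rw [h0] at this
    exact hv this
  obtain ⟨m, hm⟩ := Nat.exists_eq_succ_of_ne_zero h0
  have hle : Nat.find hex ≤ i := Nat.find_min' hex hiu
  have hadj := hi.1 m (by omega)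
  have hspec := Nat.find_spec hex
  rw [hm] at hspec ⊢
  exact (adj_region hspec (Nat.find_min hex (by omega)) hadj.symm).1

/-- If the root gets the same messages, the routes start in the same way, so that one of them
visits the wrong inner node first. -/
theorem EqUpTo.not_avoids (h : EqUpTo c₁ c₂ f f') (hc : c₁ ≠ c₂) (R : ℕ)
    (hrep : ∀ t < R, L.report A ω f t c₁ = L.report A ω f' t c₁ ∧
      L.report A ω f t c₂ = L.report A ω f' t c₂) {v u : Fin n} (hv : v ∉ L.region c₁ c₂ f)
    (hu : u ∈ L.region c₁ c₂ f) :
    ¬ L.Avoids f (tables A (L.tree f) R ω) v u (L.inner c₂) ∨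
      ¬ L.Avoids f' (tables A (L.tree f') R ω) v u (L.inner c₁) := by
  by_contra! hcon
  obtain ⟨⟨i, hi, hiav⟩, ⟨i', hi', hiav'⟩⟩ := hcon
  obtain ⟨j, hj, hjl, hjm, hjc⟩ := exists_first_entry hv hu hi
  obtain ⟨j', hj', hjl', hjm', hjc'⟩ :=
    exists_first_entry (f := f') (h.region_eq ▸ hv) (h.region_eq ▸ hu) hi'
  rw [← h.region_eq] at hjl' hjm'
  -- Up to the first entry only tables outside of the region are used, and these agree; hence
  -- positions and labels coincide, including those on entry.
  have hpk : ∀ l ≤ j, packet (tables A (L.tree f) R ω) v u l =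
      packet (tables A (L.tree f') R ω) v u l := by
    intro l
    induction l with
    | zero => intro; rfl
    | succ l ih =>
      intro hl
      simp only [packet]
      rw [← ih (by omega), h.tables_eq A ω R hrep (hjl l (by omega))]
  have hjj : j' = j := by
    rcases lt_trichotomy j' j with hlt | heq | hlt
    · exact absurd ((hpk j' hlt.le) ▸ hjm') (hjl j' hlt)
    · exact heq
    · exact absurd ((hpk j le_rfl) ▸ hjm) (hjl' j hlt)
  subst hjj
  -- Avoidance forces the common entry point to be `c₁` for `f` and `c₂` for `f'`.
  have e1 := hjc.resolve_right (hiav _ hj)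
  have e2 := hjc'.resolve_left (hiav' _ hj')
  rw [hpk _ le_rfl] at e1
  exact hc (L.inner_injective (e1.symm.trans e2))

end Layout

/-! ### Measurability, and the choice of fixed random strings. -/

section Measurability

variable {n B : ℕ} (A : RoutingAlgorithm n B) (N : Network n)

instance : IsProbabilityMeasure coinLaw := by
  unfold coinLaw
  infer_instance

instance : Finite (Message B) := List.finite_length_le Bool B

/-- There are only countably many histories, so the event can be split according to the previous
histories of the senders. -/
theorem measurableSet_history_eq (t : ℕ) : ∀ (v : Fin n) (h : List (Inbox n B)),
    MeasurableSet {ω : Fin n → Coins | history A N ω t v = h} := by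
  classical
  induction t with
  | zero => intro v h; simp only [history]; exact MeasurableSet.const _
  | succ t ih =>
    intro v h
    cases h with
    | nil => simp [history]
    | cons I h =>
      have : {ω : Fin n → Coins | history A N ω (t + 1) v = I :: h} =
          (⋂ u, ⋃ h' : List (Inbox n B), {ω | history A N ω t u = h'} ∩
            {ω | (if N.graph.Adj u v then A.send u (N.localInput u) (ω u) h' v
              else Message.empty B) = I u}) ∩ {ω | history A N ω t v = h} := by
        ext ω
        simp [history, funext_iff]
      rw [this]
      refine (MeasurableSet.iInter fun u => MeasurableSet.iUnion fun h' =>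
        (ih u h').inter ?_).inter (ih v h)
      split_ifs
      · exact (A.measurable_send u (N.localInput u) h' v (I u)).preimage (measurable_pi_apply u)
      · exact MeasurableSet.const _

theorem measurableSet_tables_eq (R : ℕ) (v : Fin n) (l : ℕ) (p : Fin n × ℕ) :
    MeasurableSet {ω : Fin n → Coins | tables A N R ω v l = p} := by
  have : {ω : Fin n → Coins | tables A N R ω v l = p} =
      ⋃ h : List (Inbox n B), {ω | history A N ω R v = h} ∩
        {ω | A.next v (N.localInput v) (ω v) h l = p} := by
    ext ω
    simp [tables]
  rw [this]
  exact MeasurableSet.iUnion fun h => (measurableSet_history_eq A N R v h).inter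
    ((A.measurable_next v (N.localInput v) h l p).preimage (measurable_pi_apply v))

theorem measurable_packet (R : ℕ) (v u : Fin n) (i : ℕ) :
    Measurable fun ω : Fin n → Coins => packet (tables A N R ω) v u i := by
  induction i with
  | zero => exact measurable_const
  | succ i ih =>
    refine measurable_to_countable' fun p => ?_
    have : (fun ω : Fin n → Coins => packet (tables A N R ω) v u (i + 1)) ⁻¹' {p} =
        ⋃ q : Fin n × ℕ, {ω | packet (tables A N R ω) v u i = q} ∩
          {ω | tables A N R ω q.1 q.2 = p} := by
      ext ω
      simp only [packet, Set.mem_preimage, Set.mem_singleton_iff, Set.mem_iUnion, Set.mem_inter_iff,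
        Set.mem_ofPred_eq, exists_eq_left']
    rw [this]
    exact MeasurableSet.iUnion fun q => (ih (measurableSet_singleton q)).inter
      (measurableSet_tables_eq A N R q.1 q.2 p)

theorem measurableSet_delivered (R : ℕ) (v u : Fin n) (i : ℕ) :
    MeasurableSet {ω : Fin n → Coins | Delivered N (tables A N R ω) v u i} := by
  have hp := measurable_packet A N R v u
  unfold Delivered
  refine MeasurableSet.inter (s₁ := {ω | ∀ j < i, _}) ?_ ?_
  · simp only [Set.ofPred_forall]
    refine MeasurableSet.iInter fun j => MeasurableSet.iInter fun _ => ?_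
    exact ((hp j).fst.prodMk (hp (j + 1)).fst)
      (MeasurableSet.of_discrete (s := {q : Fin n × Fin n | N.graph.Adj q.1 q.2}))
  · exact (hp i).fst (measurableSet_singleton u)

theorem measurable_routeWeight (R : ℕ) (v u : Fin n) :
    Measurable fun ω : Fin n → Coins => routeWeight N (tables A N R ω) v u := by
  classical
  have hp := measurable_packet A N R v u
  unfold routeWeight
  refine Measurable.iInf fun i => ?_
  simp only [iInf_eq_if]
  refine Measurable.ite (measurableSet_delivered A N R v u i) ?_ measurable_const
  push_cast
  refine Finset.measurable_sum _ fun j _ => ?_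
  exact (measurable_of_countable fun q : Fin n × Fin n => ((N.weight s(q.1, q.2) : ℕ) : ℝ≥0∞)).comp
    ((hp j).fst.prodMk (hp (j + 1)).fst)

theorem measurable_averageStretch (R : ℕ) :
    Measurable fun ω : Fin n → Coins => averageStretch N (tables A N R ω) := by
  unfold averageStretch stretch
  exact (Finset.measurable_sum _ fun v _ => Finset.measurable_sum _ fun u _ =>
    (measurable_routeWeight A N R v u).div_const _).div_const _

end Measurability

/-- Fixing the random strings: some choice is good on average for a whole family of networks. -/
theorem exists_coins_sum_averageStretch_le {n B : ℕ} (A : RoutingAlgorithm n B) (R : ℕ)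
    {ι : Type*} [Fintype ι] (N : ι → Network n) {ρ : ℝ≥0∞}
    (h : ∀ i, expectedAverageStretch A (N i) R ≤ ρ) :
    ∃ ω, ∑ i, averageStretch (N i) (tables A (N i) R ω) ≤ Fintype.card ι * ρ := by
  have hmeas := fun i => measurable_averageStretch A (N i) R
  obtain ⟨ω, hω⟩ := exists_le_lintegral (μ := Measure.pi fun _ : Fin n => coinLaw)
    (Finset.measurable_sum Finset.univ fun i _ => hmeas i).aemeasurable
  refine ⟨ω, hω.trans ?_⟩
  rw [lintegral_finsetSum _ fun i _ => hmeas i]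
  exact (Finset.sum_le_sum fun i _ => h i).trans (by simp)


/-! ### Counting transcripts and summing over pairs of inner nodes. -/

noncomputable instance (B : ℕ) : Fintype (Message B) := Fintype.ofFinite _

instance (B : ℕ) : Nonempty (Message B) := ⟨Message.empty B⟩

/-- A message is determined by its optional entries at the `B` positions, each of which has three
possible values. -/
theorem card_message_le (B : ℕ) : Fintype.card (Message B) ≤ 3 ^ B := by
  have hinj : Function.Injective fun (m : Message B) (i : Fin B) => m.1[(i : ℕ)]? := by
    intro m m' h
    refine Subtype.ext (List.ext_getElem? fun i => ?_)
    by_cases hi : i < B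
    · exact congrFun h ⟨i, hi⟩
    · rw [List.getElem?_eq_none (m.2.trans (not_lt.1 hi)),
        List.getElem?_eq_none (m'.2.trans (not_lt.1 hi))]
  simpa using Fintype.card_le_of_injective _ hinj

theorem log_card_transcripts_le (R B : ℕ) :
    Real.log (Fintype.card (Fin R → Message B × Message B)) ≤ 4 * R * B := by
  have h1 : Real.log (Fintype.card (Message B)) ≤ 2 * B := by
    have h0 : (0 : ℝ) < Fintype.card (Message B) := Nat.cast_pos.2 Fintype.card_pos
    calc Real.log (Fintype.card (Message B)) ≤ Real.log ((3 : ℝ) ^ B) :=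
          Real.log_le_log h0 (by exact_mod_cast card_message_le B)
      _ = B * Real.log 3 := Real.log_pow _ _
      _ ≤ B * 2 := by
          gcongr
          linarith [Real.log_le_sub_one_of_pos (show (0 : ℝ) < 3 by norm_num)]
      _ = _ := mul_comm _ _
  rw [Fintype.card_fun, Fintype.card_prod, Fintype.card_fin]
  push_cast
  rw [← pow_two, ← pow_mul, Real.log_pow]
  push_cast
  calc (2 * R : ℝ) * Real.log (Fintype.card (Message B)) ≤ 2 * R * (2 * B) := by gcongr
    _ = _ := by ring

namespace Layout

variable {n k B : ℕ} (L : Layout n k) (A : RoutingAlgorithm n B) (ω : Fin n → Coins) (R : ℕ)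

open Classical Finset in
-- The description of `f` is the transcript of the messages from both inner nodes to the root; a
-- guess fails where the route does not avoid the wrong one of them.
theorem sum_card_le_add_card_not_avoids {v : Fin n} (hv : v ∉ L.leaves)
    (hi : ∀ c, v ≠ L.inner c) {c₁ c₂ : Fin k} (hc : c₁ ≠ c₂) :
    ∑ f : Fin n → Fin k, (#{u ∈ L.leaves | f u = c₁ ∨ f u = c₂} : ℝ) / 4 ≤
      Fintype.card (Fin n → Fin k) * (4 * R * B) +
        ∑ f : Fin n → Fin k, (#{u ∈ L.leaves | (f u = c₁ ∨ f u = c₂) ∧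
          (f u = c₁ ∧ ¬ L.Avoids f (tables A (L.tree f) R ω) v u (L.inner c₂) ∨
            f u = c₂ ∧ ¬ L.Avoids f (tables A (L.tree f) R ω) v u (L.inner c₁))} : ℝ) := by
  refine (card_le_log_card_add_card_bad hc L.leaves
    (fun f (t : Fin R) => (L.report A ω f t c₁, L.report A ω f t c₂)) (fun f u =>
      f u = c₁ ∧ ¬ L.Avoids f (tables A (L.tree f) R ω) v u (L.inner c₂) ∨
      f u = c₂ ∧ ¬ L.Avoids f (tables A (L.tree f) R ω) v u (L.inner c₁)) ?_).trans ?_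
  · intro f f' hff hτ u hu h1 h2
    have := EqUpTo.not_avoids (L := L) A ω hff hc R (fun t ht => ?_) (v := v) (u := u) ?_ ?_
    · exact this.imp (fun h => Or.inl ⟨h1, h⟩) (fun h => Or.inr ⟨h2, h⟩)
    · simpa using congrFun hτ ⟨t, ht⟩
    · rintro (h | h | ⟨h, -⟩)
      exacts [hi _ h, hi _ h, hv h]
    · exact Or.inr (Or.inr ⟨hu, Or.inl h1⟩)
  · gcongr
    exact log_card_transcripts_le R B

open Classical Finset in
/-- Summation of `sum_card_le_add_card_not_avoids` over all pairs of inner nodes. -/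
theorem card_leaves_le_add_card_not_avoids {v : Fin n} (hv : v ∉ L.leaves)
    (hi : ∀ c, v ≠ L.inner c) :
    ((k : ℝ) - 1) * #L.leaves / 2 * Fintype.card (Fin n → Fin k) ≤
      4 * (k : ℝ) ^ 2 * R * B * Fintype.card (Fin n → Fin k) +
        2 * ∑ f : Fin n → Fin k, ∑ u ∈ L.leaves,
          (#{c | ¬ L.Avoids f (tables A (L.tree f) R ω) v u (L.inner c)} : ℝ) := by
  set M : ℝ := ((Fintype.card (Fin n → Fin k) : ℕ) : ℝ) with hM
  let F : Fin k → ℝ := fun c => ∑ f : Fin n → Fin k, (#{u ∈ L.leaves | f u = c} : ℝ)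
  let E : Fin k → Fin k → ℝ := fun c c' => ∑ f : Fin n → Fin k, (#{u ∈ L.leaves |
    f u = c ∧ ¬ L.Avoids f (tables A (L.tree f) R ω) v u (L.inner c')} : ℝ)
  have hE0 : ∀ c c', 0 ≤ E c c' := fun c c' => sum_nonneg fun _ _ => Nat.cast_nonneg _
  -- The last term makes the inequality trivial on the diagonal. In the sum it turns the factor `k /
  -- 2` into `(k - 1) / 2`.
  have hpair : ∀ c c', (F c + F c') / 4 ≤
      M * (4 * R * B) + (E c c' + E c' c) + if c = c' then F c / 2 else 0 := by
    intro c c'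
    split_ifs with hcc
    · subst hcc
      have := hE0 c c
      have : 0 ≤ M * (4 * R * B) := by positivity
      linarith
    · have h := L.sum_card_le_add_card_not_avoids A ω R hv hi hcc
      have h1 : (F c + F c') / 4 =
          ∑ f : Fin n → Fin k, (#{u ∈ L.leaves | f u = c ∨ f u = c'} : ℝ) / 4 := by
        simp only [F]
        rw [← sum_add_distrib, sum_div]
        refine sum_congr rfl fun f _ => ?_
        rw [filter_or, card_union_of_disjoint]
        · push_cast; rfl
        · refine disjoint_filter.2 fun u _ h1 h2 => hcc (h1.symm.trans h2)
      rw [h1, add_zero]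
      refine h.trans (add_le_add_right ?_ _)
      simp only [E]
      rw [← sum_add_distrib]
      refine sum_le_sum fun f _ => ?_
      rw [← Nat.cast_add, Nat.cast_le]
      refine (card_le_card ?_).trans (card_union_le _ _)
      intro u hu
      simp only [mem_filter, mem_union] at hu ⊢
      tauto
  have hF : ∑ c, F c = M * #L.leaves := by
    simp only [F]
    rw [sum_comm, hM, ← card_univ, ← nsmul_eq_mul]
    refine sum_eq_card_nsmul fun f _ => ?_
    rw [← Nat.cast_sum, ← card_eq_sum_card_fiberwise (by simp)]
  -- Each leaf has exactly one `c` with `f u = c`, so summation over `c` removes this condition.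
  have hE : ∑ c, ∑ c', E c c' = ∑ f : Fin n → Fin k, ∑ u ∈ L.leaves,
      (#{c | ¬ L.Avoids f (tables A (L.tree f) R ω) v u (L.inner c)} : ℝ) := by
    calc ∑ c, ∑ c', E c c' = ∑ c, ∑ f : Fin n → Fin k, ∑ c', (#{u ∈ L.leaves |
          f u = c ∧ ¬ L.Avoids f (tables A (L.tree f) R ω) v u (L.inner c')} : ℝ) :=
          sum_congr rfl fun c _ => sum_comm
      _ = ∑ f : Fin n → Fin k, ∑ c, ∑ c', (#{u ∈ L.leaves |
          f u = c ∧ ¬ L.Avoids f (tables A (L.tree f) R ω) v u (L.inner c')} : ℝ) := sum_comm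
      _ = _ := by
          refine sum_congr rfl fun f _ => ?_
          rw [sum_comm]
          simp only [card_filter, Nat.cast_sum, ite_and]
          rw [sum_comm (s := L.leaves) (t := univ)]
          refine sum_congr rfl fun c' _ => ?_
          rw [sum_comm]
          refine sum_congr rfl fun u _ => ?_
          simp
  have hsum := sum_le_sum fun c (_ : c ∈ univ) => sum_le_sum fun c' (_ : c' ∈ univ) => hpair c c'
  simp only [sum_add_distrib, ← sum_div, sum_const, card_univ, Fintype.card_fin, nsmul_eq_mul,
    sum_ite_eq, mem_univ, if_true, ← mul_sum] at hsum
  rw [sum_comm (f := fun c c' => E c' c), hE, hF] at hsum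
  linarith

open Classical Finset in
-- Visits to inner nodes are bounded by three times the stretch, and the pairs in question are among
-- the fewer than `n ^ 2` pairs in the average.
theorem exists_coins_card_not_avoids_le (S : Finset (Fin n)) (hS : ∀ v ∈ S, v ∉ L.leaves)
    (hr : L.root ∉ S) (hi : ∀ v ∈ S, ∀ c, v ≠ L.inner c) (hn : 2 ≤ n) {ρ : ℝ} (hρ : 0 ≤ ρ)
    (h : ∀ f, expectedAverageStretch A (L.tree f) R ≤ ENNReal.ofReal ρ) :
    ∃ ω : Fin n → Coins, ∑ v ∈ S, ∑ f : Fin n → Fin k, ∑ u ∈ L.leaves,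
      (#{c | ¬ L.Avoids f (tables A (L.tree f) R ω) v u (L.inner c)} : ℝ) ≤
        3 * ρ * (n : ℝ) ^ 2 * Fintype.card (Fin n → Fin k) := by
  obtain ⟨ω, hω⟩ := exists_coins_sum_averageStretch_le A R L.tree h
  refine ⟨ω, ?_⟩
  have hfix : ∀ f : Fin n → Fin k, ∑ v ∈ S, ∑ u ∈ L.leaves,
      (#{c | ¬ L.Avoids f (tables A (L.tree f) R ω) v u (L.inner c)} : ℝ≥0∞) ≤
        3 * (n : ℝ≥0∞) ^ 2 * averageStretch (L.tree f) (tables A (L.tree f) R ω) := by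
    intro f
    set T := tables A (L.tree f) R ω
    have hpos : ((n * (n - 1) : ℕ) : ℝ≥0∞) ≠ 0 :=
      Nat.cast_ne_zero.2 (Nat.mul_ne_zero (by omega) (by omega))
    calc ∑ v ∈ S, ∑ u ∈ L.leaves, (#{c | ¬ L.Avoids f T v u (L.inner c)} : ℝ≥0∞)
        ≤ ∑ v ∈ S, ∑ u ∈ L.leaves, 3 * stretch (L.tree f) T v u :=
          sum_le_sum fun v hv => sum_le_sum fun u hu => L.card_not_avoids_le_stretch f T
            (hS v hv) (fun h => hr (h ▸ hv)) (hi v hv) hu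
      _ ≤ ∑ v ∈ S, ∑ u ∈ univ.erase v, 3 * stretch (L.tree f) T v u :=
          sum_le_sum fun v hv => sum_le_sum_of_subset fun u hu =>
            mem_erase.2 ⟨fun h => hS v hv (h ▸ hu), mem_univ _⟩
      _ ≤ ∑ v, ∑ u ∈ univ.erase v, 3 * stretch (L.tree f) T v u :=
          sum_le_sum_of_subset (subset_univ _)
      _ = 3 * (((n * (n - 1) : ℕ) : ℝ≥0∞) * averageStretch (L.tree f) T) := by
          rw [averageStretch, ENNReal.mul_div_cancel hpos (ENNReal.natCast_ne_top _)]
          simp only [mul_sum]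
      _ ≤ 3 * (n : ℝ≥0∞) ^ 2 * averageStretch (L.tree f) T := by
          rw [← mul_assoc]
          gcongr
          rw [pow_two]
          exact_mod_cast Nat.mul_le_mul le_rfl (Nat.sub_le n 1)
  have htot : ((∑ v ∈ S, ∑ f : Fin n → Fin k, ∑ u ∈ L.leaves,
      #{c | ¬ L.Avoids f (tables A (L.tree f) R ω) v u (L.inner c)} : ℕ) : ℝ≥0∞) ≤
        ENNReal.ofReal (3 * ρ * (n : ℝ) ^ 2 * Fintype.card (Fin n → Fin k)) := by
    push_cast
    rw [sum_comm]
    calc _ ≤ ∑ f : Fin n → Fin k, 3 * (n : ℝ≥0∞) ^ 2 *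
          averageStretch (L.tree f) (tables A (L.tree f) R ω) := sum_le_sum fun f _ => hfix f
      _ ≤ 3 * (n : ℝ≥0∞) ^ 2 * (Fintype.card (Fin n → Fin k) * ENNReal.ofReal ρ) := by
          rw [← mul_sum]
          gcongr
      _ = _ := by
          rw [ENNReal.ofReal_mul (by positivity), ENNReal.ofReal_mul (by positivity),
            ENNReal.ofReal_mul (by positivity), ENNReal.ofReal_pow (by positivity),
            ENNReal.ofReal_natCast, ENNReal.ofReal_natCast, ENNReal.ofReal_ofNat]
          ring
  rw [← ENNReal.ofReal_natCast, ENNReal.ofReal_le_ofReal_iff (by positivity)] at htot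
  exact_mod_cast htot

theorem card_mul_le (S : Finset (Fin n)) (hS : ∀ v ∈ S, v ∉ L.leaves)
    (hr : L.root ∉ S) (hi : ∀ v ∈ S, ∀ c, v ≠ L.inner c) (hn : 2 ≤ n) (hk : 0 < k) {ρ : ℝ}
    (hρ : 0 ≤ ρ) (h : ∀ f, expectedAverageStretch A (L.tree f) R ≤ ENNReal.ofReal ρ) :
    (S.card : ℝ) * (((k : ℝ) - 1) * L.leaves.card / 2) ≤
      S.card * (4 * (k : ℝ) ^ 2 * R * B) + 6 * ρ * (n : ℝ) ^ 2 := by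
  obtain ⟨ω, hω⟩ := L.exists_coins_card_not_avoids_le A R S hS hr hi hn hρ h
  have hsum := Finset.sum_le_sum fun v hv =>
    L.card_leaves_le_add_card_not_avoids A ω R (hS v hv) (hi v hv)
  rw [Finset.sum_add_distrib, ← Finset.mul_sum, ← Finset.mul_sum, ← Finset.mul_sum,
    Finset.sum_const, nsmul_eq_mul] at hsum
  have : Nonempty (Fin k) := ⟨⟨0, hk⟩⟩
  have hM : (0 : ℝ) < Fintype.card (Fin n → Fin k) := Nat.cast_pos.2 Fintype.card_pos
  refine le_of_mul_le_mul_right ?_ hM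
  linarith

end Layout

/-! ### Choice of the parameters. -/

/-- A layout in which the leaves are the nodes from `2 * q` on. -/
def layoutOfLE {n k q : ℕ} (hk : k + 1 ≤ q) (hq : 3 * q ≤ n) : Layout n k where
  root := ⟨0, by omega⟩
  inner c := ⟨c + 1, by omega⟩
  leaves := Finset.univ.filter fun x => 2 * q ≤ (x : ℕ)
  inner_injective c c' h := by simpa [Fin.ext_iff] using h
  inner_ne_root c := by simp
  root_notMem := by simp; omega
  inner_notMem c := by simp; omega

theorem le_card_filter_val {n a q : ℕ} {p : Fin n → Prop} [DecidablePred p] (han : a + q ≤ n)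
    (hp : ∀ x : Fin n, a ≤ x → (x : ℕ) < a + q → p x) : q ≤ (Finset.univ.filter p).card := by
  have hinj : Function.Injective fun i : Fin q => (⟨a + i, by omega⟩ : Fin n) := by
    intro i j h
    simpa [Fin.ext_iff] using h
  have := Finset.card_le_card (s := Finset.univ.map ⟨_, hinj⟩) (t := Finset.univ.filter p) (by
    intro x hx
    obtain ⟨i, -, rfl⟩ := Finset.mem_map.1 hx
    exact Finset.mem_filter.2 ⟨Finset.mem_univ _, hp _ (by simp) (by simp)⟩)
  simpa using this

theorem le_mul_rounds_of_stretch {n B R k q : ℕ} (A : RoutingAlgorithm n B) (hk : k + 1 ≤ q)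
    (hq : 3 * q ≤ n) (hn : n ≤ 4 * q) {ρ : ℝ} (hρ : 1 ≤ ρ) (hkρ : 384 * ρ ≤ (k : ℝ) - 1)
    (h : ∀ N : Network n, N.IsTreeOfDepthLE 2 → N.UnitWeights →
      expectedAverageStretch A N R ≤ ENNReal.ofReal ρ) :
    (q : ℝ) ≤ 32 * k * (R * B) := by
  let L : Layout n k := layoutOfLE hk hq
  -- The senders: since `k + 1 ≤ q`, these nodes lie beyond the root and all inner nodes, and before
  -- the leaves.
  let S : Finset (Fin n) := Finset.univ.filter fun x => q ≤ (x : ℕ) ∧ (x : ℕ) < 2 * q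
  have hS : q ≤ S.card := le_card_filter_val (a := q) (by omega) (by intros; omega)
  have hL : q ≤ L.leaves.card := le_card_filter_val (a := 2 * q) (by omega) (by intros; omega)
  have hk0 : 0 < k := by
    rcases Nat.eq_zero_or_pos k with rfl | hk
    · norm_num at hkρ; linarith
    · exact hk
  have key := L.card_mul_le A R S
    (fun v hv => by simp [S] at hv; simp [L, layoutOfLE]; omega)
    (by simp [S, L, layoutOfLE])
    (fun v hv c => by simp [S] at hv; simp [L, layoutOfLE, Fin.ext_iff]; omega)
    (by omega) hk0 (by linarith)
    (fun f => h _ (L.tree_isTreeOfDepthLE f) (L.tree_unitWeights f))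
  have hS' : (q : ℝ) ≤ S.card := by exact_mod_cast hS
  have hL' : (q : ℝ) ≤ L.leaves.card := by exact_mod_cast hL
  have hn' : (n : ℝ) ≤ 4 * q := by exact_mod_cast hn
  have hq0 : (0 : ℝ) < q := by exact_mod_cast (by omega : 0 < q)
  have hS0 : (0 : ℝ) < S.card := hq0.trans_le hS'
  have hk1 : (0 : ℝ) < k - 1 := by linarith
  -- As `384 = 6 * 4 ^ 2 * 4`, the stretch term uses up at most half of the main term.
  have h1 : 6 * ρ * (n : ℝ) ^ 2 ≤ S.card * ((k - 1) * q / 4) := by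
    calc 6 * ρ * (n : ℝ) ^ 2 ≤ 6 * ρ * (4 * q) ^ 2 := by gcongr
      _ = q * (384 * ρ * q / 4) := by ring
      _ ≤ _ := by gcongr
  have h2 : (S.card : ℝ) * ((k - 1) * q / 2) ≤ S.card * (((k : ℝ) - 1) * L.leaves.card / 2) := by
    gcongr
  have h3 : (S.card : ℝ) * ((k - 1) * q / 4) ≤ S.card * (4 * (k : ℝ) ^ 2 * R * B) := by
    linarith
  have h4 := le_of_mul_le_mul_left h3 hS0
  have h5 : (k : ℝ) / 2 * q ≤ (k - 1) * q := by
    gcongr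
    linarith
  have h6 : (k : ℝ) * q ≤ k * (32 * k * (R * B)) := by
    nlinarith
  exact le_of_mul_le_mul_left h6 (by exact_mod_cast hk0)

end Congest

theorem mainTheorem7 (β : ℝ) (hβ : 0 < β) :
    ∃ c : ℝ, 0 < c ∧
      ∀ (n B : ℕ) (_ : 2 ≤ n) (_ : (B : ℝ) ≤ β * Real.log n)
        (ρ : ℝ) (_ : 1 ≤ ρ) (R : ℕ) (_ : 1 ≤ R) (A : Congest.RoutingAlgorithm n B),
        (∀ N : Congest.Network n, N.IsTreeOfDepthLE 2 → N.UnitWeights →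
          Congest.expectedAverageStretch A N R ≤ ENNReal.ofReal ρ) →
        c * (n / (ρ ^ 2 * Real.log n)) ≤ R := by
  -- The first constant rounds `4 * 32 * 386 = 49408`. The second serves small `n`, where `n ≤ 3 * k
  -- + 2 ≤ 1160 * ρ` and `log n ≥ 1/2` make the bound trivial by `R ≥ 1`.
  refine ⟨min (1 / (50000 * β)) (1 / 2500), by positivity, ?_⟩
  intro n B hn hB ρ hρ R hR A h
  have hn2 : (2 : ℝ) ≤ n := by exact_mod_cast hn
  have hlog2 : (1 / 2 : ℝ) ≤ Real.log n := by
    have := Real.log_le_log (by norm_num) hn2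
    linarith [Real.log_two_gt_d9]
  have hlog0 : (0 : ℝ) < Real.log n := by linarith
  have hR1 : (1 : ℝ) ≤ R := by exact_mod_cast hR
  have hρ2 : ρ ≤ ρ ^ 2 := by nlinarith
  -- Both cases below prove the bound with `ρ` in place of `ρ ^ 2`.
  have hfrac : (n : ℝ) / (ρ ^ 2 * Real.log n) ≤ n / (ρ * Real.log n) := by gcongr
  have hfrac0 : (0 : ℝ) ≤ n / (ρ ^ 2 * Real.log n) := by positivity
  set k := ⌈384 * ρ⌉₊ + 1 with hkdef
  have hk1 : 384 * ρ ≤ (k : ℝ) - 1 := by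
    rw [hkdef]
    push_cast
    linarith [Nat.le_ceil (384 * ρ)]
  have hk2 : (k : ℝ) ≤ 386 * ρ := by
    rw [hkdef]
    push_cast
    linarith [Nat.ceil_lt_add_one (show 0 ≤ 384 * ρ by linarith)]
  by_cases hq : k + 1 ≤ n / 3
  · have key := Congest.le_mul_rounds_of_stretch A hq (by omega) (by omega) hρ hk1 h
    have h4 : (n : ℝ) ≤ 4 * (n / 3 : ℕ) := by exact_mod_cast (by omega : n ≤ 4 * (n / 3))
    have h5 : (n : ℝ) ≤ R * (50000 * β) * (ρ * Real.log n) := by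
      calc (n : ℝ) ≤ 4 * (32 * k * (R * B)) := by linarith
        _ ≤ 4 * (32 * (386 * ρ) * (R * (β * Real.log n))) := by gcongr
        _ = 49408 * (R * β * (ρ * Real.log n)) := by ring
        _ ≤ 50000 * (R * β * (ρ * Real.log n)) := by gcongr; norm_num
        _ = _ := by ring
    calc min (1 / (50000 * β)) (1 / 2500) * (n / (ρ ^ 2 * Real.log n))
        ≤ 1 / (50000 * β) * (n / (ρ * Real.log n)) := by
          gcongr
          exact min_le_left _ _
      _ ≤ R := by
          rw [one_div_mul_eq_div, div_le_iff₀ (by positivity), div_le_iff₀ (by positivity)]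
          exact h5
  · have h4 : (n : ℝ) ≤ 3 * k + 2 := by exact_mod_cast (by omega : n ≤ 3 * k + 2)
    calc min (1 / (50000 * β)) (1 / 2500) * (n / (ρ ^ 2 * Real.log n))
        ≤ 1 / 2500 * (n / (ρ * Real.log n)) := by
          gcongr
          exact min_le_right _ _
      _ ≤ 1 := by
          rw [one_div_mul_eq_div, div_le_iff₀ (by positivity), div_le_iff₀ (by positivity)]
          nlinarith
      _ ≤ R := hR1
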